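/- Let $n,k,q$ be positive integers with $k<n$, let $X\in\mathbb R^{n\times k}$ with $\operatorname{rank}X=k$, let $R\in\mathbb R^{q\times k}$ with $\operatorname{rank}R=q$, and let $r\in\mathbb R^q$. Write $\operatorname{span}(B)$ for the column space of a matrix $B$. Put $\mathfrak M_0=\{X\beta:\beta\in\mathbb R^k,\ R\beta=r\}$ and let $\mathfrak M_0^{lin}$ be the linear space parallel to $\mathfrak M_0$. Let $\mathfrak C$ be a covariance model, i.e. a nonempty set of symmetric positive definite real $n\times n$ matrices such that $\Sigma\in\mathfrak C$ implies $\delta\Sigma\notin\mathfrak C$ for every real $\delta\neq1$. Let $P_{\mu,A}$ denote the Gaussian distribution on $\mathbb R^n$ with mean $\mu$ and covariance matrix $A$. For a linear subspace $\mathcal L$ of $\mathbb R^n$ with $\dim\mathcal L<n$, let $\Pi$ be the orthogonal projection onto $\mathcal L^\perp$, fix any norm $\|\cdot\|$ on $\mathbb R^{n\times n}$, put $\mathcal L(\Sigma)=\Pi\Sigma\Pi/\|\Pi\Sigma\Pi\|$ for $\Sigma\in\mathfrak C$, and let $$\mathbb J(\mathcal L,\mathfrak C)=\{\operatorname{span}(\bar\Sigma):\bar\Sigma\in\operatorname{cl}\{\mathcal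 L(\Sigma):\Sigma\in\mathfrak C\},\ \operatorname{rank}\bar\Sigma<n-\dim\mathcal L\}.$$ Let $\check\beta:\mathbb R^n\to\mathbb R^k$ and $\check\Omega:\mathbb R^n\to\mathbb R^{q\times q}$ be continuous, with $\check\Omega(y)$ symmetric and nonnegative definite for every $y\in\mathbb R^n$ and nonsingular for Lebesgue-almost every $y$, and suppose that $\check\beta(\delta y+X\eta)=\delta\check\beta(y)+\eta$ and $\check\Omega(\delta y+X\eta)=\delta^2\check\Omega(y)$ for all $y\in\mathbb R^n$, all real $\delta\ne0$ and all $\eta\in\mathbb R^k$. Define $T(y)=(R\check\beta(y)-r)'\check\Omega(y)^{-1}(R\check\beta(y)-r)$ if $\det\check\Omega(y)\neq0$, and $T(y)=0$ otherwise. **Theorem.** If some $\mathcal S\in\mathbb J(\mathfrak M_0^{lin},\mathfrak C)$ satisfies $\mathcal S\subseteq\operatorname{span}(X)$, then $$\sup_{\Sigma\in\mathfrak C}P_{\mu_0,\sigma^2\Sigma}(T\ge C)=1$$ for every $C\in\mathbb R$, every $\mu_0\in\mathfrak M_0$ and every $\sigma^2\in(0,\infty)$. -/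

import Mathlib

open MeasureTheory ProbabilityTheory
open scoped Matrix

noncomputable section

/-- A covariance model: a nonempty set of symmetric positive definite `n × n` matrices such that
`σ²` and `Σ` are uniquely determined by `σ² Σ`. -/
structure IsCovarianceModel {n : ℕ} (cov : Set (Matrix (Fin n) (Fin n) ℝ)) : Prop where
  nonempty : cov.Nonempty
  posDef : ∀ A ∈ cov, A.PosDef
  smul_notMem : ∀ A ∈ cov, ∀ δ : ℝ, δ ≠ 1 → δ • A ∉ cov

/-- `span(B)`: the subspace of `ℝˡ` spanned by the columns of the `l × m` matrix `B`. -/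
def colSpan {l m : ℕ} (B : Matrix (Fin l) (Fin m) ℝ) : Submodule ℝ (EuclideanSpace ℝ (Fin l)) :=
  Submodule.span ℝ (Set.range fun j : Fin m => WithLp.toLp 2 (B.col j))

/-- The affine space `𝔐₀ = {X β : R β = r}` of means compatible with the null hypothesis. -/
def nullMeans {n k q : ℕ} (X : Matrix (Fin n) (Fin k) ℝ) (R : Matrix (Fin q) (Fin k) ℝ)
    (r : Fin q → ℝ) : AffineSubspace ℝ (EuclideanSpace ℝ (Fin n)) where
  carrier := {μ | ∃ β : Fin k → ℝ, μ = WithLp.toLp 2 (X *ᵥ β) ∧ R *ᵥ β = r}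
  smul_vsub_vadd_mem' := by
    rintro c _ _ _ ⟨b₁, rfl, h₁⟩ ⟨b₂, rfl, h₂⟩ ⟨b₃, rfl, h₃⟩
    refine ⟨c • (b₁ - b₂) + b₃, ?_, ?_⟩
    · simp [Matrix.mulVec_add, Matrix.mulVec_smul, Matrix.mulVec_sub]
    · simp [Matrix.mulVec_add, Matrix.mulVec_smul, Matrix.mulVec_sub, h₁, h₂, h₃]

/-- `𝔐₀^lin`: the linear space parallel to `𝔐₀`. -/
def nullMeansLin {n k q : ℕ} (X : Matrix (Fin n) (Fin k) ℝ) (R : Matrix (Fin q) (Fin k) ℝ)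
    (r : Fin q → ℝ) : Submodule ℝ (EuclideanSpace ℝ (Fin n)) :=
  (nullMeans X R r).direction

/-- The matrix (in the standard basis) of the orthogonal projection onto `L`. -/
def projMatrix {n : ℕ} (L : Submodule ℝ (EuclideanSpace ℝ (Fin n))) : Matrix (Fin n) (Fin n) ℝ :=
  (Matrix.toEuclideanCLM (n := Fin n) (𝕜 := ℝ)).symm L.starProjection

/-- `𝓛(Σ) = Π Σ Π / ‖Π Σ Π‖`, where `Π` is the orthogonal projection onto the orthogonal
complement of `L` and where `‖·‖` is `ν`. -/
def normalizedProj {n : ℕ} (ν : Seminorm ℝ (Matrix (Fin n) (Fin n) ℝ))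
    (L : Submodule ℝ (EuclideanSpace ℝ (Fin n))) (A : Matrix (Fin n) (Fin n) ℝ) :
    Matrix (Fin n) (Fin n) ℝ :=
  (ν (projMatrix Lᗮ * A * projMatrix Lᗮ))⁻¹ • (projMatrix Lᗮ * A * projMatrix Lᗮ)

/-- The collection `𝕁(𝓛, ℭ)` of all spaces `span(B)` with `B` in the closure of
`{𝓛(Σ) : Σ ∈ ℭ}` and `rank B < n - dim 𝓛`. It is used for norms `ν` only. -/
def concSpaces {n : ℕ} (ν : Seminorm ℝ (Matrix (Fin n) (Fin n) ℝ))
    (L : Submodule ℝ (EuclideanSpace ℝ (Fin n))) (cov : Set (Matrix (Fin n) (Fin n) ℝ)) :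
    Set (Submodule ℝ (EuclideanSpace ℝ (Fin n))) :=
  {S | ∃ B ∈ closure (normalizedProj ν L '' cov),
    B.rank + Module.finrank ℝ L < n ∧ S = colSpan B}

/-- The conditions on the estimators `bC` of `β` and `omC` underlying a nonsphericity-corrected
F-type statistic. The estimators are defined off the exceptional set `N`; they are represented by
total functions whose values on `N` are never used. -/
structure EstimatorAssumption {n k q : ℕ} (X : Matrix (Fin n) (Fin k) ℝ)
    (N : Set (EuclideanSpace ℝ (Fin n)))
    (bC : EuclideanSpace ℝ (Fin n) → Fin k → ℝ)
    (omC : EuclideanSpace ℝ (Fin n) → Matrix (Fin q) (Fin q) ℝ) : Prop where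
  isClosed : IsClosed N
  null : volume N = 0
  continuousOn_beta : ContinuousOn bC Nᶜ
  continuousOn_omega : ContinuousOn omC Nᶜ
  symm : ∀ y ∉ N, (omC y).IsSymm
  invariant : ∀ y ∉ N, ∀ δ : ℝ, δ ≠ 0 → ∀ η : Fin k → ℝ, δ • y + WithLp.toLp 2 (X *ᵥ η) ∉ N
  equivariant_beta : ∀ y ∉ N, ∀ δ : ℝ, δ ≠ 0 → ∀ η : Fin k → ℝ,
    bC (δ • y + WithLp.toLp 2 (X *ᵥ η)) = δ • bC y + η
  equivariant_omega : ∀ y ∉ N, ∀ δ : ℝ, δ ≠ 0 → ∀ η : Fin k → ℝ,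
    omC (δ • y + WithLp.toLp 2 (X *ᵥ η)) = δ ^ 2 • omC y
  ae_nonsingular : ∀ᵐ y ∂(volume : Measure (EuclideanSpace ℝ (Fin n))), y ∉ N → (omC y).det ≠ 0

/-- The set `N* = N ∪ {y ∉ N : det Ω(y) = 0}`. -/
def exceptionalSet {n q : ℕ} (N : Set (EuclideanSpace ℝ (Fin n)))
    (omC : EuclideanSpace ℝ (Fin n) → Matrix (Fin q) (Fin q) ℝ) :
    Set (EuclideanSpace ℝ (Fin n)) :=
  N ∪ {y | y ∉ N ∧ (omC y).det = 0}

open Classical in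
/-- The F-type test statistic: `(R b(y) - r)' Ω(y)⁻¹ (R b(y) - r)` off `N*`, and `0` on `N*`. -/
def fTypeStat {n k q : ℕ} (R : Matrix (Fin q) (Fin k) ℝ) (r : Fin q → ℝ)
    (N : Set (EuclideanSpace ℝ (Fin n)))
    (bC : EuclideanSpace ℝ (Fin n) → Fin k → ℝ)
    (omC : EuclideanSpace ℝ (Fin n) → Matrix (Fin q) (Fin q) ℝ)
    (y : EuclideanSpace ℝ (Fin n)) : ℝ :=
  if y ∈ exceptionalSet N omC then 0
  else (R *ᵥ bC y - r) ⬝ᵥ ((omC y)⁻¹ *ᵥ (R *ᵥ bC y - r))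

end

/-!
The statistic `T` is invariant under `μ₀ + u ↦ μ₀ + δ u + l` for `δ ≠ 0` and `l` in the linear space
`L` parallel to the null means (`fTypeStat_affine`). Hence, with `Π` the orthogonal projection onto
`Lᗮ` and `z` a standard Gaussian vector, `T(μ₀ + (s² Σ)^{1/2} z) = T(μ₀ + W z)` almost surely, where
`W = c Π (s² Σ)^{1/2}` and the scale `c` is chosen such that `W Wᵀ = 𝓛(Σ)`
(`exists_smul_gram_eq_normalizedProj`).

Let `B` be the limit of matrices `𝓛(Σₘ)` with `span(B) ⊆ span(X)`. The corresponding `Wₘ` have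
convergent Gram matrices, so along a subsequence they converge to some `V` with `V Vᵀ = B`
(`exists_subseq_tendsto_of_gram_tendsto`). The points `μ₀ + Wₘ z` thus converge, for every fixed
`z`, to `μ₀ + V z`, which lies in `span(X)`. On `span(X)` equivariance forces `Ω` to vanish and
`b(X β) = β` (`estimators_on_colSpan`). Moreover `V z ≠ 0` almost surely because `B ≠ 0`, and
`V z ∈ Lᗮ`, so the limit is not a null mean and `R b(y) ≠ r` there. By Cauchy–Schwarz
`T(y) ≥ |R b(y) - r|⁴ / (R b(y) - r)' Ω(y) (R b(y) - r)`, and therefore `T` diverges along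
`μ₀ + Wₘ z` (`eventually_le_fTypeStat`). Since this holds for almost every `z`, the rejection
probabilities have supremum one (`measure_univ_le_iSup_of_ae_eventually`).
-/

open scoped MatrixOrder

/-! ### Absolute continuity of Gaussian distributions -/

/-- Finite products of absolutely continuous measures are absolutely continuous. -/
lemma pi_absolutelyContinuous_of_forall {m : ℕ} {μ ν : Fin m → Measure ℝ}
    [∀ i, SigmaFinite (μ i)] [∀ i, SigmaFinite (ν i)] (h : ∀ i, μ i ≪ ν i) :
    Measure.pi μ ≪ Measure.pi ν := by
  induction m with
  | zero => rw [Measure.pi_of_empty, Measure.pi_of_empty]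
  | succ m ih =>
    have h1 := (measurePreserving_piFinSuccAbove μ 0).symm.map_eq
    have h2 := (measurePreserving_piFinSuccAbove ν 0).symm.map_eq
    rw [← h1, ← h2]
    exact ((h 0).prod (ih fun i => h _)).map (MeasurableEquiv.measurable _)

lemma stdGaussian_absolutelyContinuous (n : ℕ) :
    stdGaussian (EuclideanSpace ℝ (Fin n)) ≪ volume := by
  rw [← map_pi_eq_stdGaussian, ← (PiLp.volume_preserving_toLp (Fin n)).map_eq]
  exact (pi_absolutelyContinuous_of_forall fun _ =>
    gaussianReal_absolutelyContinuous 0 one_ne_zero).map (by fun_prop)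

/-- An almost sure property remains almost sure after a nonsingular affine change of variables of
a standard Gaussian vector. -/
lemma ae_stdGaussian_affine {n : ℕ} {p : EuclideanSpace ℝ (Fin n) → Prop}
    (hp : ∀ᵐ y ∂(volume : Measure (EuclideanSpace ℝ (Fin n))), p y)
    (μ : EuclideanSpace ℝ (Fin n)) {S : Matrix (Fin n) (Fin n) ℝ} (hS : S.det ≠ 0) :
    ∀ᵐ z ∂(stdGaussian (EuclideanSpace ℝ (Fin n))),
      p (μ + Matrix.toEuclideanCLM (𝕜 := ℝ) S z) := by
  rw [ae_iff] at hp ⊢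
  refine stdGaussian_absolutelyContinuous n ?_
  have h1 : volume ((fun y => μ + y) ⁻¹' {y | ¬ p y}) = 0 := by rw [measure_preimage_add, hp]
  have hdet : LinearMap.det (Matrix.toEuclideanCLM (𝕜 := ℝ) S).toLinearMap ≠ 0 := by
    change LinearMap.det (Matrix.toLpLin 2 2 S) ≠ 0
    simpa using hS
  have h2 := Measure.addHaar_preimage_linearMap
    (volume : Measure (EuclideanSpace ℝ (Fin n))) hdet ((fun y => μ + y) ⁻¹' {y | ¬ p y})
  rw [h1, mul_zero] at h2
  exact h2

lemma ae_stdGaussian_mulVec_ne_zero {n : ℕ} {W : Matrix (Fin n) (Fin n) ℝ} (hW : W ≠ 0) :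
    ∀ᵐ z ∂(stdGaussian (EuclideanSpace ℝ (Fin n))), Matrix.toEuclideanCLM (𝕜 := ℝ) W z ≠ 0 := by
  rw [ae_iff]
  refine stdGaussian_absolutelyContinuous n ?_
  have : (Matrix.toEuclideanCLM (𝕜 := ℝ) W).toLinearMap.ker ≠ ⊤ := by
    intro h
    apply hW
    have h0 : Matrix.toEuclideanCLM (𝕜 := ℝ) W = 0 := by
      ext1 z
      have : z ∈ (Matrix.toEuclideanCLM (𝕜 := ℝ) W).toLinearMap.ker := h ▸ Submodule.mem_top
      simpa using this
    simpa using h0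
  convert Measure.addHaar_submodule volume _ this using 2
  ext z
  simp

/-- If almost every point eventually lies in `E m`, then the measures of the `E m` come arbitrarily
close to full measure. The sets need not be measurable. -/
lemma measure_univ_le_iSup_of_ae_eventually {Ω : Type*} [MeasurableSpace Ω] (μ : Measure Ω)
    {E : ℕ → Set Ω} (h : ∀ᵐ z ∂μ, ∀ᶠ m in Filter.atTop, z ∈ E m) :
    μ Set.univ ≤ ⨆ m, μ (E m) := by
  have hmono : Monotone fun M => ⋂ m ≥ M, E m := fun a b hab =>
    Set.biInter_subset_biInter_left fun m (hm : b ≤ m) => le_trans hab hm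
  calc μ Set.univ = μ (⋃ M, ⋂ m ≥ M, E m) := by
        refine measure_congr ?_
        filter_upwards [h] with z hz
        refine propext ⟨fun _ => ?_, fun _ => trivial⟩
        obtain ⟨M, hM⟩ := Filter.eventually_atTop.1 hz
        exact Set.mem_iUnion.2 ⟨M, Set.mem_iInter₂.2 hM⟩
    _ = ⨆ M, μ (⋂ m ≥ M, E m) := hmono.measure_iUnion
    _ ≤ ⨆ m, μ (E m) := iSup_mono fun M => measure_mono (Set.biInter_subset_of_mem (show M ≥ M from le_rfl))

/-! ### Matrices -/

instance matrix_firstCountableTopology {l m : ℕ} :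
    FirstCountableTopology (Matrix (Fin l) (Fin m) ℝ) :=
  inferInstanceAs (FirstCountableTopology (Fin l → Fin m → ℝ))

lemma mem_colSpan_iff {l m : ℕ} {B : Matrix (Fin l) (Fin m) ℝ} {u : EuclideanSpace ℝ (Fin l)} :
    u ∈ colSpan B ↔ ∃ x, u = WithLp.toLp 2 (B *ᵥ x) := by
  rw [colSpan, Submodule.mem_span_range_iff_exists_fun]
  refine exists_congr fun x => ?_
  rw [eq_comm]
  refine Eq.congr_right ?_
  ext i
  simp [Matrix.mulVec, dotProduct, mul_comm]

lemma exists_self_mul_transpose_mulVec_eq {l m : ℕ} (W : Matrix (Fin l) (Fin m) ℝ)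
    (z : Fin m → ℝ) : ∃ x, (W * Wᵀ) *ᵥ x = W *ᵥ z := by
  have hle : LinearMap.range (W * Wᵀ).mulVecLin ≤ LinearMap.range W.mulVecLin := by
    rw [Matrix.mulVecLin_mul]
    exact LinearMap.range_comp_le_range _ _
  have heq := Submodule.eq_of_le_of_finrank_eq hle (Matrix.rank_self_mul_transpose W)
  have : W *ᵥ z ∈ LinearMap.range (W * Wᵀ).mulVecLin := heq ▸ ⟨z, rfl⟩
  exact this

/-- A seminorm is bounded by a multiple of the sup of the entries, hence continuous at `0`. -/
lemma seminorm_tendsto_zero {n : ℕ} (ν : Seminorm ℝ (Matrix (Fin n) (Fin n) ℝ))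
    {A : ℕ → Matrix (Fin n) (Fin n) ℝ} (hA : Filter.Tendsto A Filter.atTop (nhds 0)) :
    Filter.Tendsto (fun m => ν (A m)) Filter.atTop (nhds 0) := by
  have hbound : ∀ M : Matrix (Fin n) (Fin n) ℝ,
      ν M ≤ ∑ i, ∑ j, |M i j| * ν (Matrix.single i j 1) := by
    intro M
    conv_lhs => rw [Matrix.matrix_eq_sum_single M]
    refine (Finset.le_sum_of_subadditive ν (map_zero ν).le (map_add_le_add ν) _ _).trans
      (Finset.sum_le_sum fun i _ => ?_)
    refine (Finset.le_sum_of_subadditive ν (map_zero ν).le (map_add_le_add ν) _ _).trans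
      (Finset.sum_le_sum fun j _ => ?_)
    rw [← Real.norm_eq_abs, ← map_smul_eq_mul, Matrix.smul_single, smul_eq_mul, mul_one]
  refine squeeze_zero (fun m => apply_nonneg ν _) (fun m => hbound (A m)) ?_
  have hc : Continuous fun M : Matrix (Fin n) (Fin n) ℝ =>
      ∑ i, ∑ j, |M i j| * ν (Matrix.single i j 1) := by fun_prop
  simpa [Function.comp_def] using (hc.tendsto 0).comp hA

/-- Matrices `W m` whose Gram matrices `W m (W m)ᵀ` converge are bounded, as the squared entries of
`W m` are at most the diagonal entries of the Gram matrix; so a subsequence converges. -/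
lemma exists_subseq_tendsto_of_gram_tendsto {n : ℕ} {W : ℕ → Matrix (Fin n) (Fin n) ℝ}
    {B : Matrix (Fin n) (Fin n) ℝ}
    (h : Filter.Tendsto (fun m => W m * (W m)ᵀ) Filter.atTop (nhds B)) :
    ∃ V : Matrix (Fin n) (Fin n) ℝ, V * Vᵀ = B ∧ ∃ φ : ℕ → ℕ, StrictMono φ ∧
      Filter.Tendsto (W ∘ φ) Filter.atTop (nhds V) := by
  have hentry : ∀ i, ∃ c : ℝ, ∀ m, (W m * (W m)ᵀ) i i ≤ c := by
    intro i
    have hi : Filter.Tendsto (fun m => (W m * (W m)ᵀ) i i) Filter.atTop (nhds (B i i)) :=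
      ((continuous_id.matrix_elem i i).tendsto B).comp h
    obtain ⟨c, hc⟩ := hi.bddAbove_range
    exact ⟨c, fun m => hc ⟨m, rfl⟩⟩
  choose c hc using hentry
  let K : Set (Matrix (Fin n) (Fin n) ℝ) :=
    Set.pi Set.univ fun i => Set.pi Set.univ fun _ : Fin n => Set.Icc (-√(c i)) (√(c i))
  have hK : IsCompact K := isCompact_univ_pi fun i => isCompact_univ_pi fun _ => isCompact_Icc
  have hWK : ∀ m, W m ∈ K := by
    intro m i _ j _
    rw [Set.mem_Icc, ← abs_le]
    refine Real.abs_le_sqrt (le_trans ?_ (hc i m))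
    rw [Matrix.mul_apply, sq]
    exact Finset.single_le_sum (f := fun j => W m i j * (W m)ᵀ j i)
      (fun j _ => mul_self_nonneg (W m i j)) (Finset.mem_univ j)
  obtain ⟨V, -, φ, hφ, hV⟩ := hK.tendsto_subseq hWK
  refine ⟨V, ?_, φ, hφ, hV⟩
  have hcont : Continuous fun M : Matrix (Fin n) (Fin n) ℝ => M * Mᵀ := by fun_prop
  exact tendsto_nhds_unique ((hcont.tendsto V).comp hV) (h.comp hφ.tendsto_atTop)

/-- The Cauchy–Schwarz inequality for the inner product defined by `A`, applied to `A⁻¹ v` and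
`v`. -/
lemma dotProduct_self_sq_le {q : ℕ} {A : Matrix (Fin q) (Fin q) ℝ} (hA : A.PosSemidef)
    (hdet : A.det ≠ 0) (v : Fin q → ℝ) :
    (v ⬝ᵥ v) ^ 2 ≤ (v ⬝ᵥ (A *ᵥ v)) * (v ⬝ᵥ (A⁻¹ *ᵥ v)) := by
  have hsymm : Aᵀ = A := by simpa using hA.isHermitian.eq
  have hinv : A *ᵥ (A⁻¹ *ᵥ v) = v := by
    rw [Matrix.mulVec_mulVec, Matrix.mul_nonsing_inv _ (isUnit_iff_ne_zero.2 hdet),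
      Matrix.one_mulVec]
  have hcross : (A⁻¹ *ᵥ v) ⬝ᵥ (A *ᵥ v) = v ⬝ᵥ v := by
    rw [Matrix.dotProduct_mulVec, ← Matrix.mulVec_transpose, hsymm, hinv]
  have hquad : ∀ t : ℝ, 0 ≤ (v ⬝ᵥ (A *ᵥ v)) * (t * t) + (-2 * (v ⬝ᵥ v)) * t
      + v ⬝ᵥ (A⁻¹ *ᵥ v) := by
    intro t
    have h := hA.dotProduct_mulVec_nonneg (A⁻¹ *ᵥ v - t • v)
    rw [star_trivial, Matrix.mulVec_sub, Matrix.mulVec_smul, hinv] at h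
    simp only [sub_dotProduct, dotProduct_sub, smul_dotProduct, dotProduct_smul, smul_eq_mul,
      hcross, dotProduct_comm (A⁻¹ *ᵥ v) v] at h
    linarith
  have := discrim_le_zero hquad
  rw [discrim] at this
  linarith

/-! ### The test statistic -/

section Statistic

variable {n k q : ℕ} {X : Matrix (Fin n) (Fin k) ℝ} {R : Matrix (Fin q) (Fin k) ℝ}
  {r : Fin q → ℝ} {bC : EuclideanSpace ℝ (Fin n) → Fin k → ℝ}
  {omC : EuclideanSpace ℝ (Fin n) → Matrix (Fin q) (Fin q) ℝ}

lemma fTypeStat_of_det_ne_zero {y : EuclideanSpace ℝ (Fin n)} (h : (omC y).det ≠ 0) :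
    fTypeStat R r ∅ bC omC y = (R *ᵥ bC y - r) ⬝ᵥ ((omC y)⁻¹ *ᵥ (R *ᵥ bC y - r)) := by
  simp [fTypeStat, exceptionalSet, h]

lemma mem_nullMeansLin_iff {μ₀ : EuclideanSpace ℝ (Fin n)} (hμ₀ : μ₀ ∈ nullMeans X R r)
    {u : EuclideanSpace ℝ (Fin n)} :
    u ∈ nullMeansLin X R r ↔ ∃ γ : Fin k → ℝ, u = WithLp.toLp 2 (X *ᵥ γ) ∧ R *ᵥ γ = 0 := by
  obtain ⟨β₀, h₀, hr₀⟩ := id hμ₀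
  rw [nullMeansLin, AffineSubspace.mem_direction_iff_eq_vsub_right hμ₀]
  constructor
  · rintro ⟨_, ⟨β, rfl, hβ⟩, rfl⟩
    exact ⟨β - β₀, by simp [h₀, Matrix.mulVec_sub], by simp [Matrix.mulVec_sub, hβ, hr₀]⟩
  · rintro ⟨γ, rfl, hγ⟩
    refine ⟨μ₀ + WithLp.toLp 2 (X *ᵥ γ), ⟨β₀ + γ, ?_, ?_⟩, ?_⟩
    · simp [h₀, Matrix.mulVec_add]
    · simp [Matrix.mulVec_add, hγ, hr₀]
    · simp

/-- Under the maps `μ₀ + u ↦ μ₀ + δ u + l`, with `l` in the linear space parallel to the null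
means, the discrepancy `R b(y) - r` is multiplied by `δ` and `Ω(y)` by `δ²`. -/
lemma estimators_of_affine (hest : EstimatorAssumption X ∅ bC omC)
    {μ₀ : EuclideanSpace ℝ (Fin n)} (hμ₀ : μ₀ ∈ nullMeans X R r) {δ : ℝ} (hδ : δ ≠ 0)
    (u : EuclideanSpace ℝ (Fin n)) {l : EuclideanSpace ℝ (Fin n)} (hl : l ∈ nullMeansLin X R r) :
    R *ᵥ bC (μ₀ + δ • u + l) - r = δ • (R *ᵥ bC (μ₀ + u) - r) ∧
      omC (μ₀ + δ • u + l) = δ ^ 2 • omC (μ₀ + u) := by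
  obtain ⟨γ, rfl, hγ⟩ := (mem_nullMeansLin_iff hμ₀).1 hl
  obtain ⟨β₀, rfl, rfl⟩ := hμ₀
  have hy : WithLp.toLp 2 (X *ᵥ β₀) + δ • u + WithLp.toLp 2 (X *ᵥ γ)
      = δ • (WithLp.toLp 2 (X *ᵥ β₀) + u) + WithLp.toLp 2 (X *ᵥ ((1 - δ) • β₀ + γ)) := by
    simp only [Matrix.mulVec_add, Matrix.mulVec_smul, WithLp.toLp_add, WithLp.toLp_smul]
    module
  rw [hy, hest.equivariant_beta _ (Set.notMem_empty _) δ hδ,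
    hest.equivariant_omega _ (Set.notMem_empty _) δ hδ]
  refine ⟨?_, rfl⟩
  simp only [Matrix.mulVec_add, Matrix.mulVec_smul, hγ]
  module

lemma fTypeStat_affine (hest : EstimatorAssumption X ∅ bC omC)
    {μ₀ : EuclideanSpace ℝ (Fin n)} (hμ₀ : μ₀ ∈ nullMeans X R r) {δ : ℝ} (hδ : δ ≠ 0)
    {u : EuclideanSpace ℝ (Fin n)} {l : EuclideanSpace ℝ (Fin n)} (hl : l ∈ nullMeansLin X R r)
    (hdet : (omC (μ₀ + u)).det ≠ 0) :
    (omC (μ₀ + δ • u + l)).det ≠ 0 ∧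
      fTypeStat R r ∅ bC omC (μ₀ + δ • u + l) = fTypeStat R r ∅ bC omC (μ₀ + u) := by
  obtain ⟨h1, h2⟩ := estimators_of_affine hest hμ₀ hδ u hl
  have hdet' : (omC (μ₀ + δ • u + l)).det ≠ 0 := by
    rw [h2, Matrix.det_smul]
    exact mul_ne_zero (pow_ne_zero _ (pow_ne_zero _ hδ)) hdet
  refine ⟨hdet', ?_⟩
  have hinv : (δ ^ 2 • omC (μ₀ + u))⁻¹ = (δ ^ 2)⁻¹ • (omC (μ₀ + u))⁻¹ := by
    refine Matrix.inv_eq_left_inv ?_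
    rw [Matrix.smul_mul, Matrix.mul_smul, smul_smul, inv_mul_cancel₀ (pow_ne_zero _ hδ), one_smul,
      Matrix.nonsing_inv_mul _ (isUnit_iff_ne_zero.2 hdet)]
  rw [fTypeStat_of_det_ne_zero hdet', fTypeStat_of_det_ne_zero hdet, h1, h2, hinv]
  simp only [Matrix.smul_mulVec, Matrix.mulVec_smul, smul_dotProduct, dotProduct_smul,
    smul_eq_mul]
  field_simp

/-- Equivariance forces `b(X β) = β` and `Ω(X β) = 0`. -/
lemma estimators_on_colSpan (hest : EstimatorAssumption X ∅ bC omC) (β : Fin k → ℝ) :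
    bC (WithLp.toLp 2 (X *ᵥ β)) = β ∧ omC (WithLp.toLp 2 (X *ᵥ β)) = 0 := by
  have hb : bC 0 = 0 := by
    have h := hest.equivariant_beta 0 (Set.notMem_empty _) 2 two_ne_zero 0
    simp only [smul_zero, Matrix.mulVec_zero, WithLp.toLp_zero, add_zero, two_smul] at h
    simpa using h
  have ho : omC 0 = 0 := by
    have h := hest.equivariant_omega 0 (Set.notMem_empty _) 2 two_ne_zero 0
    simp only [smul_zero, Matrix.mulVec_zero, WithLp.toLp_zero, add_zero] at h
    have h3 : (3 : ℝ) • omC 0 = 0 := by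
      calc (3 : ℝ) • omC 0 = (2 : ℝ) ^ 2 • omC 0 - omC 0 := by module
        _ = 0 := by rw [← h, sub_self]
    exact (smul_eq_zero.1 h3).resolve_left (by norm_num)
  have h1 := hest.equivariant_beta 0 (Set.notMem_empty _) 1 one_ne_zero β
  have h2 := hest.equivariant_omega 0 (Set.notMem_empty _) 1 one_ne_zero β
  rw [smul_zero, zero_add] at h1 h2
  exact ⟨by rw [h1, hb]; simp, by rw [h2, ho, smul_zero]⟩

/-- The statistic diverges along nonsingular points `y m` that approach a point at which `Ω`
vanishes and which violates the restriction `R b(y) = r`. -/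
lemma eventually_le_fTypeStat (hest : EstimatorAssumption X ∅ bC omC)
    (hpsd : ∀ y, (omC y).PosSemidef) {y : ℕ → EuclideanSpace ℝ (Fin n)}
    {y₀ : EuclideanSpace ℝ (Fin n)} (hy : Filter.Tendsto y Filter.atTop (nhds y₀))
    (hdet : ∀ m, (omC (y m)).det ≠ 0) (h0 : omC y₀ = 0) (hne : R *ᵥ bC y₀ - r ≠ 0) (C : ℝ) :
    ∀ᶠ m in Filter.atTop, C ≤ fTypeStat R r ∅ bC omC (y m) := by
  have hcb : Continuous bC := by
    simpa [continuousOn_univ] using hest.continuousOn_beta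
  have hco : Continuous omC := by
    simpa [continuousOn_univ] using hest.continuousOn_omega
  let d : EuclideanSpace ℝ (Fin n) → Fin q → ℝ := fun y => R *ᵥ bC y - r
  have hcd : Continuous d := by fun_prop
  have hcl : Continuous fun y => C * (d y ⬝ᵥ (omC y *ᵥ d y)) := by fun_prop
  have hcr : Continuous fun y => (d y ⬝ᵥ d y) ^ 2 := by fun_prop
  have hlt : C * (d y₀ ⬝ᵥ (omC y₀ *ᵥ d y₀)) < (d y₀ ⬝ᵥ d y₀) ^ 2 := by
    have : d y₀ ⬝ᵥ d y₀ ≠ 0 := mt dotProduct_self_eq_zero.1 hne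
    simp only [h0, Matrix.zero_mulVec, dotProduct_zero, mul_zero]
    positivity
  have hpos : 0 < (d y₀ ⬝ᵥ d y₀) ^ 2 := by
    have : d y₀ ⬝ᵥ d y₀ ≠ 0 := mt dotProduct_self_eq_zero.1 hne
    positivity
  filter_upwards [((hcl.tendsto y₀).comp hy).eventually_lt ((hcr.tendsto y₀).comp hy) hlt,
    ((hcr.tendsto y₀).comp hy).eventually_const_lt hpos] with m hm hm'
  rw [fTypeStat_of_det_ne_zero (hdet m)]
  have hcs := dotProduct_self_sq_le (hpsd (y m)) (hdet m) (d (y m))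
  have hnn : 0 ≤ d (y m) ⬝ᵥ (omC (y m) *ᵥ d (y m)) := by
    simpa using (hpsd (y m)).dotProduct_mulVec_nonneg (d (y m))
  simp only [Function.comp_apply] at hm hm'
  have hpos' : 0 < d (y m) ⬝ᵥ (omC (y m) *ᵥ d (y m)) := by
    refine lt_of_le_of_ne hnn fun h => ?_
    rw [← h, zero_mul] at hcs
    exact absurd hm' (not_lt.2 hcs)
  change C ≤ d (y m) ⬝ᵥ ((omC (y m))⁻¹ *ᵥ d (y m))
  nlinarith

end Statistic

/-! ### Square roots of the normalized projected covariance matrices -/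

section Projection

variable {n : ℕ} (L : Submodule ℝ (EuclideanSpace ℝ (Fin n)))

lemma toEuclideanCLM_projMatrix :
    Matrix.toEuclideanCLM (n := Fin n) (𝕜 := ℝ) (projMatrix L) = L.starProjection := by
  simp [projMatrix]

lemma projMatrix_transpose : (projMatrix L)ᵀ = projMatrix L := by
  have h : star (projMatrix L) = projMatrix L := by
    apply EquivLike.injective (Matrix.toEuclideanCLM (n := Fin n) (𝕜 := ℝ))
    rw [map_star, toEuclideanCLM_projMatrix]
    exact (isSelfAdjoint_starProjection L)
  simpa [Matrix.star_eq_conjTranspose] using h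

lemma projMatrix_mul_self : projMatrix L * projMatrix L = projMatrix L := by
  apply EquivLike.injective (Matrix.toEuclideanCLM (n := Fin n) (𝕜 := ℝ))
  rw [map_mul, toEuclideanCLM_projMatrix]
  exact L.isIdempotentElem_starProjection

lemma projMatrix_mul_mul_ne_zero {A : Matrix (Fin n) (Fin n) ℝ} (hA : A.PosDef) (hL : L ≠ ⊥) :
    projMatrix L * A * projMatrix L ≠ 0 := by
  intro h
  obtain ⟨u, hu, hu0⟩ := Submodule.exists_mem_ne_zero_of_ne_bot hL
  have hPu : projMatrix L *ᵥ u.ofLp = u.ofLp := by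
    rw [← Matrix.ofLp_toEuclideanCLM, toEuclideanCLM_projMatrix,
      Submodule.starProjection_eq_self_iff.2 hu]
  have hpos : 0 < u.ofLp ⬝ᵥ (A *ᵥ u.ofLp) := by
    simpa using hA.dotProduct_mulVec_pos (x := u.ofLp) (by simpa using hu0)
  have hz : u.ofLp ⬝ᵥ ((projMatrix L * A * projMatrix L) *ᵥ u.ofLp) = 0 := by
    rw [h, Matrix.zero_mulVec, dotProduct_zero]
  rw [← Matrix.mulVec_mulVec, hPu, ← Matrix.mulVec_mulVec, Matrix.dotProduct_mulVec,
    ← Matrix.mulVec_transpose, projMatrix_transpose, hPu] at hz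
  exact hpos.ne' hz

lemma sqrt_transpose (A : Matrix (Fin n) (Fin n) ℝ) : (CFC.sqrt A)ᵀ = CFC.sqrt A := by
  simpa [Matrix.star_eq_conjTranspose] using (CFC.sqrt_nonneg A).isSelfAdjoint.star_eq

lemma sqrt_mul_sqrt_of_posDef {A : Matrix (Fin n) (Fin n) ℝ} (hA : A.PosDef) :
    CFC.sqrt A * CFC.sqrt A = A := by
  exact CFC.sqrt_mul_sqrt_self A hA.posSemidef.nonneg

lemma det_sqrt_ne_zero {A : Matrix (Fin n) (Fin n) ℝ} (hA : A.PosDef) : (CFC.sqrt A).det ≠ 0 := by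
  intro h
  have := congrArg Matrix.det (sqrt_mul_sqrt_of_posDef hA)
  rw [Matrix.det_mul, h, mul_zero] at this
  exact hA.det_pos.ne this

/-- For a suitable scale `c ≠ 0`, the matrix `c Π (s A)^{1/2}` is a factor `W` of
`𝓛(A) = W Wᵀ`. -/
lemma exists_smul_gram_eq_normalizedProj (ν : Seminorm ℝ (Matrix (Fin n) (Fin n) ℝ))
    {A : Matrix (Fin n) (Fin n) ℝ} (hA : A.PosDef) {s : ℝ} (hs : 0 < s)
    (hν : ν (projMatrix Lᗮ * A * projMatrix Lᗮ) ≠ 0) :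
    ∃ c : ℝ, c ≠ 0 ∧ (c • (projMatrix Lᗮ * CFC.sqrt (s • A))) *
      (c • (projMatrix Lᗮ * CFC.sqrt (s • A)))ᵀ = normalizedProj ν L A := by
  set t := ν (projMatrix Lᗮ * A * projMatrix Lᗮ) with ht
  have htpos : 0 < t := lt_of_le_of_ne (apply_nonneg ν _) (Ne.symm hν)
  refine ⟨√((s * t)⁻¹), (Real.sqrt_pos.2 (by positivity)).ne', ?_⟩
  rw [Matrix.transpose_smul, Matrix.transpose_mul, sqrt_transpose, projMatrix_transpose,
    Matrix.smul_mul, Matrix.mul_smul, smul_smul, Real.mul_self_sqrt (by positivity),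
    Matrix.mul_assoc, ← Matrix.mul_assoc (CFC.sqrt _), sqrt_mul_sqrt_of_posDef (hA.smul hs),
    Matrix.smul_mul, Matrix.mul_smul, smul_smul, normalizedProj, ← ht, Matrix.mul_assoc]
  congr 1
  field_simp

end Projection

theorem theorem3p2 {n k q : ℕ} (hk : 1 ≤ k) (hkn : k < n) (hq : 1 ≤ q)
    (X : Matrix (Fin n) (Fin k) ℝ) (hX : X.rank = k)
    (R : Matrix (Fin q) (Fin k) ℝ) (hR : R.rank = q) (r : Fin q → ℝ)
    (cov : Set (Matrix (Fin n) (Fin n) ℝ)) (hcov : IsCovarianceModel cov)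
    (bC : EuclideanSpace ℝ (Fin n) → Fin k → ℝ)
    (omC : EuclideanSpace ℝ (Fin n) → Matrix (Fin q) (Fin q) ℝ)
    (hest : EstimatorAssumption X ∅ bC omC)
    (hpsd : ∀ y, (omC y).PosSemidef)
    (ν : Seminorm ℝ (Matrix (Fin n) (Fin n) ℝ)) (hν : ∀ A, ν A = 0 → A = 0)
    (hS : ∃ S ∈ concSpaces ν (nullMeansLin X R r) cov, S ≤ colSpan X)
    (C : ℝ) (μ₀ : EuclideanSpace ℝ (Fin n)) (hμ₀ : μ₀ ∈ nullMeans X R r)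
    (s2 : ℝ) (hs2 : 0 < s2) :
    ⨆ A ∈ cov, multivariateGaussian μ₀ (s2 • A) {y | C ≤ fTypeStat R r ∅ bC omC y} = 1 := by
  refine le_antisymm (iSup₂_le fun A _ => prob_le_one) ?_
  set L := nullMeansLin X R r with hL
  obtain ⟨_, ⟨B, hB, hrank, rfl⟩, hBX⟩ := hS
  have hLbot : Lᗮ ≠ ⊥ := by
    intro h
    rw [Submodule.orthogonal_eq_bot_iff] at h
    rw [h, finrank_top, finrank_euclideanSpace_fin] at hrank
    omega
  obtain ⟨N, hN, hNlim⟩ := mem_closure_iff_seq_limit.1 hB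
  choose A hA hAN using hN
  have hpd : ∀ m, (A m).PosDef := fun m => hcov.posDef _ (hA m)
  have hne : ∀ m, ν (projMatrix Lᗮ * A m * projMatrix Lᗮ) ≠ 0 := fun m h =>
    projMatrix_mul_mul_ne_zero Lᗮ (hpd m) hLbot (hν _ h)
  choose c hc hcN using fun m => exists_smul_gram_eq_normalizedProj L ν (hpd m) hs2 (hne m)
  -- `B ≠ 0`, because `B` is a limit of matrices of norm one.
  have hB0 : B ≠ 0 := by
    rintro rfl
    have hone : ∀ m, ν (N m) = 1 := fun m => by
      rw [← hAN m, normalizedProj, map_smul_eq_mul, norm_inv,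
        Real.norm_of_nonneg (apply_nonneg ν _), inv_mul_cancel₀ (hne m)]
    have := seminorm_tendsto_zero ν hNlim
    simp only [hone] at this
    exact one_ne_zero (tendsto_nhds_unique tendsto_const_nhds this)
  have hgram : Filter.Tendsto
      (fun m => (c m • (projMatrix Lᗮ * CFC.sqrt (s2 • A m))) *
        (c m • (projMatrix Lᗮ * CFC.sqrt (s2 • A m)))ᵀ) Filter.atTop (nhds B) := by
    simpa only [hcN, hAN] using hNlim
  obtain ⟨V, hVB, φ, -, hVlim⟩ := exists_subseq_tendsto_of_gram_tendsto hgram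
  have hV0 : V ≠ 0 := by
    rintro rfl
    exact hB0 (by rw [← hVB, Matrix.zero_mul])
  have hPV : projMatrix Lᗮ * V = V := by
    have hcont : Continuous fun M : Matrix (Fin n) (Fin n) ℝ => projMatrix Lᗮ * M := by fun_prop
    refine tendsto_nhds_unique (((hcont.tendsto V).comp hVlim).congr fun m => ?_) hVlim
    simp only [Function.comp_apply, Matrix.mul_smul, ← Matrix.mul_assoc, projMatrix_mul_self]
  have hdetae : ∀ᵐ z ∂(stdGaussian (EuclideanSpace ℝ (Fin n))), ∀ m,
      (omC (μ₀ + Matrix.toEuclideanCLM (𝕜 := ℝ) (CFC.sqrt (s2 • A (φ m))) z)).det ≠ 0 := by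
    refine ae_all_iff.2 fun m => ae_stdGaussian_affine
      (p := fun y => (omC y).det ≠ 0) ?_ μ₀ (det_sqrt_ne_zero ((hpd _).smul hs2))
    filter_upwards [hest.ae_nonsingular] with y hy using hy (Set.notMem_empty y)
  have hev : ∀ᵐ z ∂(stdGaussian (EuclideanSpace ℝ (Fin n))), ∀ᶠ m in Filter.atTop,
      z ∈ (fun x => μ₀ + Matrix.toEuclideanCLM (𝕜 := ℝ) (CFC.sqrt (s2 • A (φ m))) x) ⁻¹'
        {y | C ≤ fTypeStat R r ∅ bC omC y} := by
    filter_upwards [hdetae, ae_stdGaussian_mulVec_ne_zero hV0] with z hz hVz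
    -- Replacing `u` by `c u` and then subtracting the component in `L` leaves the statistic alone.
    have hmove : ∀ m, ∃ l ∈ L,
        μ₀ + Matrix.toEuclideanCLM (𝕜 := ℝ)
            (c (φ m) • (projMatrix Lᗮ * CFC.sqrt (s2 • A (φ m)))) z =
          μ₀ + c (φ m) • Matrix.toEuclideanCLM (𝕜 := ℝ) (CFC.sqrt (s2 • A (φ m))) z + l := by
      intro m
      set u := Matrix.toEuclideanCLM (𝕜 := ℝ) (CFC.sqrt (s2 • A (φ m))) z with hu
      refine ⟨-(c (φ m) • L.starProjection u),
        L.neg_mem (L.smul_mem _ (L.starProjection_apply_mem u)), ?_⟩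
      have hsum := L.starProjection_add_starProjection_orthogonal u
      rw [map_smul, map_mul, toEuclideanCLM_projMatrix, smul_apply,
        mul_apply_eq_comp, ← hu]
      nth_rewrite 2 [← hsum]
      module
    choose l hl hleq using hmove
    have hinv := fun m => fTypeStat_affine hest hμ₀ (hc (φ m)) (hl m) (hz m)
    simp only [← hleq] at hinv
    -- The limit `μ₀ + V z` lies in `span X` but not among the null means.
    obtain ⟨x, hx⟩ := exists_self_mul_transpose_mulVec_eq V z.ofLp
    rw [hVB] at hx
    have hmem : Matrix.toEuclideanCLM (𝕜 := ℝ) V z ∈ colSpan X :=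
      hBX (mem_colSpan_iff.2 ⟨x, by rw [hx, ← Matrix.ofLp_toEuclideanCLM]⟩)
    obtain ⟨β, hβ⟩ := mem_colSpan_iff.1 hmem
    have hRβ : R *ᵥ β ≠ 0 := by
      intro h
      have hVL : Matrix.toEuclideanCLM (𝕜 := ℝ) V z ∈ L :=
        (mem_nullMeansLin_iff hμ₀).2 ⟨β, hβ, h⟩
      apply hVz
      rw [← hPV, map_mul, toEuclideanCLM_projMatrix, mul_apply_eq_comp]
      exact Submodule.starProjection_orthogonal_apply_eq_zero hVL
    obtain ⟨β₀, hβ₀, hr₀⟩ := id hμ₀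
    have hlimit : μ₀ + Matrix.toEuclideanCLM (𝕜 := ℝ) V z = WithLp.toLp 2 (X *ᵥ (β₀ + β)) := by
      rw [hβ, hβ₀, Matrix.mulVec_add, WithLp.toLp_add]
    obtain ⟨hb, ho⟩ := estimators_on_colSpan hest (β₀ + β)
    rw [← hlimit] at hb ho
    have hcont : Continuous fun M : Matrix (Fin n) (Fin n) ℝ =>
        μ₀ + Matrix.toEuclideanCLM (𝕜 := ℝ) M z := by
      have : Continuous fun M : Matrix (Fin n) (Fin n) ℝ => WithLp.toLp 2 (M *ᵥ z.ofLp) := by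
        fun_prop
      exact continuous_const.add this
    have hlarge := eventually_le_fTypeStat (R := R) (r := r) hest hpsd
      ((hcont.tendsto V).comp hVlim) (fun m => (hinv m).1) ho
      (by rw [hb, Matrix.mulVec_add, hr₀, add_sub_cancel_left]; exact hRβ) C
    filter_upwards [hlarge] with m hm
    exact hm.trans_eq (hinv m).2
  calc (1 : ENNReal) = stdGaussian (EuclideanSpace ℝ (Fin n)) Set.univ := measure_univ.symm
    _ ≤ ⨆ m, _ := measure_univ_le_iSup_of_ae_eventually _ hev
    _ ≤ ⨆ A ∈ cov, multivariateGaussian μ₀ (s2 • A) {y | C ≤ fTypeStat R r ∅ bC omC y} :=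
      iSup_le fun m => (Measure.le_map_apply (by fun_prop) _).trans
        (le_iSup₂ (f := fun A (_ : A ∈ cov) =>
          multivariateGaussian μ₀ (s2 • A) {y | C ≤ fTypeStat R r ∅ bC omC y}) (A (φ m)) (hA _))
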